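/- Let $k$ be a field of characteristic zero and let $\alpha,\beta\in k$ with $\beta\neq 0$. Assume that $k$ contains both roots $\lambda,\mu$ of $t^2-\alpha t-\beta$, so that $\alpha=\lambda+\mu$ and $\beta=-\lambda\mu$. Let $A=A(\alpha,\beta,0)$ be the down-up algebra, i.e. the associative unital $k$-algebra generated by $u$ and $d$ subject to $$du^2=\alpha\,udu+\beta\,u^2d,\qquad d^2u=\alpha\,dud+\beta\,ud^2 .$$ Then $A$ has a non-trivial stably free right ideal, that is, a finitely generated right ideal $K$ which is stably free but not free as a right $A$-module. More precisely, put $\omega=du-\lambda ud$ and $r=1+u\omega$. Then the right ideal $K=\{f\in A : rf\in dA\}$ is finitely generated, stably free and not free, it is isomorphic to $rA\cap dA$ as a right $A$-module, and it is generated by the two elements $$d^2\quad\text{and}\quad du\,\omega+\lambda^{-1}\mu\,\omega^2+\mu^2 d .$$ -/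

import Mathlib

/-- The two generators of a down-up algebra. -/
inductive DownUpGen : Type
  | up
  | down

/-- The defining relations of the down-up algebra `A(α, β, γ)`:
`D U² = α U D U + β U² D + γ U` and `D² U = α D U D + β U D² + γ D`. -/
inductive DownUpRel {k : Type*} [Field k] (α β γ : k) :
    FreeAlgebra k DownUpGen → FreeAlgebra k DownUpGen → Prop
  | up_rel :
      DownUpRel α β γ
        (FreeAlgebra.ι k DownUpGen.down * FreeAlgebra.ι k DownUpGen.up ^ 2)
        (α • (FreeAlgebra.ι k DownUpGen.up * FreeAlgebra.ι k DownUpGen.down *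
              FreeAlgebra.ι k DownUpGen.up) +
          β • (FreeAlgebra.ι k DownUpGen.up ^ 2 * FreeAlgebra.ι k DownUpGen.down) +
          γ • FreeAlgebra.ι k DownUpGen.up)
  | down_rel :
      DownUpRel α β γ
        (FreeAlgebra.ι k DownUpGen.down ^ 2 * FreeAlgebra.ι k DownUpGen.up)
        (α • (FreeAlgebra.ι k DownUpGen.down * FreeAlgebra.ι k DownUpGen.up *
              FreeAlgebra.ι k DownUpGen.down) +
          β • (FreeAlgebra.ι k DownUpGen.up * FreeAlgebra.ι k DownUpGen.down ^ 2) +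
          γ • FreeAlgebra.ι k DownUpGen.down)

/-- The down-up algebra `A(α, β, γ)` over the field `k`: the associative unital algebra on two
generators subject to the two defining relations. -/
abbrev DownUpAlgebra {k : Type*} [Field k] (α β γ : k) : Type _ :=
  RingQuot (DownUpRel α β γ)

namespace DownUpAlgebra

/-- The generator `u` of `A(α, β, γ)`. -/
noncomputable def u {k : Type*} [Field k] (α β γ : k) : DownUpAlgebra α β γ :=
  RingQuot.mkAlgHom k (DownUpRel α β γ) (FreeAlgebra.ι k DownUpGen.up)

/-- The generator `d` of `A(α, β, γ)`. -/
noncomputable def d {k : Type*} [Field k] (α β γ : k) : DownUpAlgebra α β γ :=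
  RingQuot.mkAlgHom k (DownUpRel α β γ) (FreeAlgebra.ι k DownUpGen.down)

/-- The element `d u - l u d` of `A(α, β, γ)`. -/
noncomputable def omega {k : Type*} [Field k] (α β γ l : k) : DownUpAlgebra α β γ :=
  d α β γ * u α β γ - l • (u α β γ * d α β γ)

end DownUpAlgebra

/-- Right ideals of a ring `A`: submodules of `A` as a right module over itself, that is, as a
module over the opposite ring. -/
abbrev RightIdeal (A : Type*) [Ring A] : Type _ := Submodule Aᵐᵒᵖ A

/-- The right ideal of `A` generated by the set `s`. -/
abbrev RightIdeal.generatedBy {A : Type*} [Ring A] (s : Set A) : RightIdeal A :=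
  Submodule.span Aᵐᵒᵖ s

/-! ### Right ideals and stable freeness -/

section RightIdeals

variable {A : Type*} [Ring A]

/-! Write w for ω. An identity r p + d q = 1 makes A² → A, (x, y) ↦ r x + d y, a split surjection;
as d is regular, its kernel is K, so A² ≅ K × A and K is stably free. The same cofactor p yields the
two generators: if r f = d g, then f = (1 - p r) f + p d g.

Suppose K is free. A maps to k, so it has invariant basis number and K = gA. Since d² ∈ K, g is a
left divisor of d². Leading terms in the basis u^i w^j d^n force g = d^i v with v a unit of k[d] and
i ≤ 2. If i ≤ 1 then d ∈ K, and if i = 2 then the second generator lies in d²A; either way w² ∈ dA,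
which leading terms exclude.

The basis comes from an explicit action of A on the span of the monomials. Additivity of leading
exponents (`hasLeadingExponent_mul`) also shows that A is a domain. -/

theorem RightIdeal.mem_generatedBy_singleton {a x : A} :
    x ∈ RightIdeal.generatedBy {a} ↔ ∃ y, a * y = x := by
  rw [RightIdeal.generatedBy, Submodule.mem_span_singleton]
  exact ⟨fun ⟨y, hy⟩ ↦ ⟨y.unop, hy⟩, fun ⟨y, hy⟩ ↦ ⟨.op y, hy⟩⟩

theorem RightIdeal.mul_mem (K : RightIdeal A) {a : A} (ha : a ∈ K) (y : A) : a * y ∈ K :=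
  K.smul_mem (.op y) ha

/-- The right ideal of all `f` with `r * f ∈ d A`. -/
def RightIdeal.quotient (r d : A) : RightIdeal A :=
  (RightIdeal.generatedBy {d}).comap (LinearMap.mulLeft Aᵐᵒᵖ r)

theorem RightIdeal.mem_quotient {r d f : A} :
    f ∈ RightIdeal.quotient r d ↔ r * f ∈ RightIdeal.generatedBy {d} :=
  Iff.rfl

theorem RightIdeal.mem_quotient_iff_exists {r d f : A} :
    f ∈ RightIdeal.quotient r d ↔ ∃ h, d * h = r * f :=
  RightIdeal.mem_quotient.trans RightIdeal.mem_generatedBy_singleton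

/-- If `r` is left regular, then left multiplication by `r` identifies `{f | r * f ∈ d A}` with
`r A ∩ d A`. -/
theorem RightIdeal.quotient_equiv_inf {r : A} (d : A) (hr : ∀ x, r * x = 0 → x = 0) :
    Nonempty (RightIdeal.quotient r d ≃ₗ[Aᵐᵒᵖ]
      ↥(RightIdeal.generatedBy {r} ⊓ RightIdeal.generatedBy {d})) := by
  have hinj : Function.Injective (LinearMap.mulLeft Aᵐᵒᵖ r) :=
    (injective_iff_map_eq_zero _).2 hr
  have hrange : LinearMap.range (LinearMap.mulLeft Aᵐᵒᵖ r) = RightIdeal.generatedBy {r} := by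
    ext x
    rw [RightIdeal.mem_generatedBy_singleton]
    rfl
  refine ⟨(Submodule.equivMapOfInjective _ hinj _).trans (LinearEquiv.ofEq _ _ ?_)⟩
  rw [RightIdeal.quotient, Submodule.map_comap_eq, hrange]

/-- If `r A + d A = A` with `d` left regular, then `{f | r * f ∈ d A}` is a complement of `A`
in `A × A`. -/
theorem RightIdeal.prod_equiv_quotient_prod {r d p q : A} (hd : ∀ x, d * x = 0 → x = 0)
    (h : r * p + d * q = 1) :
    Nonempty ((A × A) ≃ₗ[Aᵐᵒᵖ] (RightIdeal.quotient r d × A)) := by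
  let φ : A × A →ₗ[Aᵐᵒᵖ] A :=
    (LinearMap.mulLeft Aᵐᵒᵖ r).coprod (LinearMap.mulLeft Aᵐᵒᵖ d)
  have hφ (x y : A) : φ (x, y) = r * x + d * y := rfl
  have hrp : r * p = 1 - d * q := eq_sub_of_add_eq h
  -- The map a ↦ (p a, q a) splits φ; π is the first coordinate of the resulting projection onto the
  -- kernel of φ.
  let π : A × A →ₗ[Aᵐᵒᵖ] A := LinearMap.fst _ _ _ - LinearMap.mulLeft Aᵐᵒᵖ p ∘ₗ φ
  have hπ (x y : A) : π (x, y) = x - p * (r * x + d * y) := rfl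
  have hmem (z : A × A) : π z ∈ RightIdeal.quotient r d := by
    obtain ⟨x, y⟩ := z
    refine RightIdeal.mem_quotient_iff_exists.2 ⟨q * (r * x + d * y) - y, ?_⟩
    rw [hπ, mul_sub r, ← mul_assoc r p, hrp]
    noncomm_ring
  refine ⟨LinearEquiv.ofBijective ((π.codRestrict _ hmem).prod φ) ⟨?_, ?_⟩⟩
  · refine (injective_iff_map_eq_zero _).2 ?_
    rintro ⟨x, y⟩ hxy
    have h1 : x - p * (r * x + d * y) = 0 := congrArg (fun z ↦ (z.1 : A)) hxy
    have h2 : r * x + d * y = 0 := congrArg Prod.snd hxy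
    have hx : x = 0 := by simpa [h2] using h1
    have hy : y = 0 := hd y (by simpa [hx] using h2)
    rw [hx, hy, Prod.mk_zero_zero]
  · rintro ⟨⟨f, hf⟩, a⟩
    obtain ⟨g, hg⟩ := RightIdeal.mem_quotient_iff_exists.1 hf
    have key : r * (f + p * a) + d * (q * a - g) = a := by
      rw [mul_add, ← mul_assoc r p, hrp, mul_sub d, hg]
      noncomm_ring
    refine ⟨(f + p * a, q * a - g), Prod.ext (Subtype.ext ?_) key⟩
    change f + p * a - p * (r * (f + p * a) + d * (q * a - g)) = f
    rw [key, add_sub_cancel_right]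

/-- The regular right module is free on one generator. -/
noncomputable def RightIdeal.basisUnit (A : Type*) [Ring A] : Module.Basis Unit Aᵐᵒᵖ A :=
  (Module.Basis.singleton Unit Aᵐᵒᵖ).map (MulOpposite.opLinearEquiv Aᵐᵒᵖ).symm

theorem RightIdeal.isStablyFree_quotient {r d p q : A} (hd : ∀ x, d * x = 0 → x = 0)
    (h : r * p + d * q = 1) : Module.IsStablyFree Aᵐᵒᵖ (RightIdeal.quotient r d) := by
  obtain ⟨e⟩ := RightIdeal.prod_equiv_quotient_prod hd h
  have : Module.Free Aᵐᵒᵖ A := .of_basis (RightIdeal.basisUnit A)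
  have : Module.Finite Aᵐᵒᵖ A := .of_basis (RightIdeal.basisUnit A)
  have : Module.Free Aᵐᵒᵖ (RightIdeal.quotient r d × A) := .of_equiv e
  exact .of_free_prod Aᵐᵒᵖ _ A

/-- A pair of mutually inverse rectangular matrices stays such a pair when f is applied entrywise.
-/
theorem InvariantBasisNumber.of_ringHom {R S : Type*} [Ring R] [Ring S] [InvariantBasisNumber S]
    (f : R →+* S) : InvariantBasisNumber R := by
  refine invariantBasisNumber_iff_matrix.2 fun n m P Q hPQ hQP ↦
    invariantBasisNumber_iff_matrix.1 ‹_› n m (P.map f) (Q.map f) ?_ ?_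
  · rw [← Matrix.map_mul, hPQ, Matrix.map_one f f.map_zero f.map_one]
  · rw [← Matrix.map_mul, hQP, Matrix.map_one f f.map_zero f.map_one]

/-- Over a ring with invariant basis number, a finitely generated free right ideal `K` with
`K × A ≃ A × A` is principal. -/
theorem RightIdeal.exists_eq_generatedBy_singleton [InvariantBasisNumber A] (K : RightIdeal A)
    [Module.Finite Aᵐᵒᵖ K] [Module.Free Aᵐᵒᵖ K] (e : (A × A) ≃ₗ[Aᵐᵒᵖ] (K × A)) :
    ∃ g, K = RightIdeal.generatedBy {g} := by
  have : InvariantBasisNumber Aᵐᵒᵖ := MulOpposite.invariantBasisNumber_iff.2 ‹_›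
  have : Nontrivial Aᵐᵒᵖ := nontrivial_of_invariantBasisNumber _
  let b := Module.Free.chooseBasis Aᵐᵒᵖ K
  have : Finite (Module.Free.ChooseBasisIndex Aᵐᵒᵖ K) := Module.Finite.finite_basis b
  have := Fintype.ofFinite (Module.Free.ChooseBasisIndex Aᵐᵒᵖ K)
  let c := RightIdeal.basisUnit A
  -- Comparing bases of A × A and K × A gives 2 = rank K + 1.
  have hcard := Fintype.card_congr (((c.prod c).map e).indexEquiv (b.prod c))
  simp only [Fintype.card_sum, Fintype.card_unit, Nat.add_right_cancel_iff] at hcard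
  obtain ⟨i, hi⟩ := Fintype.card_eq_one_iff.1 hcard.symm
  refine ⟨b i, le_antisymm (fun x hx ↦ ?_) ?_⟩
  · have hsum := b.sum_repr ⟨x, hx⟩
    rw [Fintype.sum_eq_single i (fun j hj ↦ absurd (hi j) hj)] at hsum
    exact Submodule.mem_span_singleton.2 ⟨_, congrArg Subtype.val hsum⟩
  · exact (Submodule.span_singleton_le_iff_mem _ _).2 (b i).2

end RightIdeals

/-! ### Identities among u, w, d -/

section Identities

set_option linter.unusedSimpArgs false
set_option linter.unnecessarySeqFocus false

variable {k A : Type*} [Field k] [Ring A] [Algebra k A] {l m : k} {u w d : A}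

/-- The relations between `u`, `d` and `w = d u - l u d` in the down-up algebra
`A(l + m, -l m, 0)`. -/
structure IsDownUpTriple (l m : k) (u w d : A) : Prop where
  w_mul_u : w * u = m • (u * w)
  d_mul_w : d * w = m • (w * d)
  d_mul_u : d * u = l • (u * d) + w

namespace IsDownUpTriple

/-- With the next two lemmas, this lets `simp` apply the relations inside right-associated products.
Words are thereby sorted into the order u, w, d, and the identities below reduce to comparing
scalars. -/
theorem w_mul_u_mul (h : IsDownUpTriple l m u w d) (x : A) : w * (u * x) = m • (u * (w * x)) := by
  rw [← mul_assoc, h.w_mul_u, smul_mul_assoc, mul_assoc]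

theorem d_mul_w_mul (h : IsDownUpTriple l m u w d) (x : A) : d * (w * x) = m • (w * (d * x)) := by
  rw [← mul_assoc, h.d_mul_w, smul_mul_assoc, mul_assoc]

theorem d_mul_u_mul (h : IsDownUpTriple l m u w d) (x : A) :
    d * (u * x) = l • (u * (d * x)) + w * x := by
  rw [← mul_assoc, h.d_mul_u, add_mul, smul_mul_assoc, mul_assoc]

variable (h : IsDownUpTriple l m u w d) (hl : l ≠ 0) (hm : m ≠ 0)
include h hl hm

-- The certificate for rA + dA = A.
omit hl in
theorem one_add_mul_add_eq_one :
    (1 + u * w) * (1 - u * w - (l * m⁻¹ ^ 2) • (d * u ^ 2)) +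
      d * ((l * m⁻¹ ^ 2) • u ^ 2 + m⁻¹ ^ 3 • (u * w * u ^ 2)) = 1 := by
  simp only [pow_two, mul_add, add_mul, mul_sub, sub_mul, mul_one, one_mul, smul_mul_assoc,
    mul_smul_comm, smul_add, smul_smul, mul_assoc, h.w_mul_u, h.d_mul_w, h.d_mul_u,
    h.w_mul_u_mul, h.d_mul_w_mul, h.d_mul_u_mul]
  match_scalars <;> field_simp <;> ring

/-- The remainder in w² is the obstruction to d ∈ K. -/
theorem one_add_mul_d :
    (1 + u * w) * d = d * (1 + (m⁻¹ * l⁻¹) • (u * w)) - (m⁻¹ * l⁻¹) • w ^ 2 := by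
  simp only [pow_two, mul_add, add_mul, mul_sub, sub_mul, mul_one, one_mul, smul_mul_assoc,
    mul_smul_comm, smul_add, smul_smul, mul_assoc, h.w_mul_u, h.d_mul_w, h.d_mul_u,
    h.w_mul_u_mul, h.d_mul_w_mul, h.d_mul_u_mul]
  match_scalars <;> field_simp <;> ring

/-- One more factor d removes the obstruction, since w² d = m⁻² d w². -/
theorem one_add_mul_d_sq :
    (1 + u * w) * d ^ 2 =
      d * (d + (m⁻¹ ^ 2 * l⁻¹) • (u * d * w) - (m⁻¹ ^ 3 * l⁻¹) • w ^ 2) := by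
  simp only [pow_two, mul_add, add_mul, mul_sub, sub_mul, mul_one, one_mul, smul_mul_assoc,
    mul_smul_comm, smul_add, smul_smul, mul_assoc, h.w_mul_u, h.d_mul_w, h.d_mul_u,
    h.w_mul_u_mul, h.d_mul_w_mul, h.d_mul_u_mul]
  match_scalars <;> field_simp <;> ring

theorem one_add_mul_generator :
    (1 + u * w) * (d * u * w + (l⁻¹ * m) • w ^ 2 + m ^ 2 • d) =
      d * (u * w + algebraMap k A (m ^ 2) + (m⁻¹ * l⁻¹) • (u * w * u * w) +
        (m * l⁻¹) • (u * w)) := by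
  simp only [Algebra.algebraMap_eq_smul_one, pow_two, mul_add, add_mul, mul_sub, sub_mul, mul_one,
    one_mul, smul_mul_assoc,
    mul_smul_comm, smul_add, smul_smul, mul_assoc, h.w_mul_u, h.d_mul_w, h.d_mul_u,
    h.w_mul_u_mul, h.d_mul_w_mul, h.d_mul_u_mul]
  match_scalars <;> field_simp

/-- With p the cofactor of r, this and `cofactor_mul_d` place 1 - p r and p d in the right ideal of
the two generators. -/
theorem one_sub_mul_one_add :
    1 - (1 - u * w - (l * m⁻¹ ^ 2) • (d * u ^ 2)) * (1 + u * w) =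
      (d * u * w + (l⁻¹ * m) • w ^ 2 + m ^ 2 • d) * ((l * m⁻¹ ^ 4) • u ^ 2) := by
  simp only [pow_two, mul_add, add_mul, mul_sub, sub_mul, mul_one, one_mul, smul_mul_assoc,
    mul_smul_comm, smul_add, smul_smul, mul_assoc, h.w_mul_u, h.d_mul_w, h.d_mul_u,
    h.w_mul_u_mul, h.d_mul_w_mul, h.d_mul_u_mul]
  match_scalars <;> field_simp <;> ring

theorem cofactor_mul_d :
    (1 - u * w - (l * m⁻¹ ^ 2) • (d * u ^ 2)) * d =
      (d * u * w + (l⁻¹ * m) • w ^ 2 + m ^ 2 • d) * algebraMap k A (m⁻¹ ^ 2) +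
        d ^ 2 * (-(l⁻¹ * m⁻¹ ^ 2) • u ^ 2) := by
  simp only [Algebra.algebraMap_eq_smul_one, pow_two, mul_add, add_mul, mul_sub, sub_mul, mul_one,
    one_mul, smul_mul_assoc,
    mul_smul_comm, smul_add, smul_smul, mul_assoc, h.w_mul_u, h.d_mul_w, h.d_mul_u,
    h.w_mul_u_mul, h.d_mul_w_mul, h.d_mul_u_mul]
  match_scalars <;> field_simp <;> ring

/-- The right ideal `{f | (1 + u w) f ∈ d A}` is generated by two elements. -/
theorem quotient_eq_generatedBy :
    RightIdeal.quotient (1 + u * w) d =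
      RightIdeal.generatedBy {d ^ 2, d * u * w + (l⁻¹ * m) • w ^ 2 + m ^ 2 • d} := by
  refine le_antisymm (fun f hf ↦ ?_) (Submodule.span_le.2 ?_)
  · obtain ⟨g, hg⟩ := RightIdeal.mem_quotient_iff_exists.1 hf
    -- This is f = (1 - p r) f + p (r f), with r f = d g.
    have hfg : f = (1 - (1 - u * w - (l * m⁻¹ ^ 2) • (d * u ^ 2)) * (1 + u * w)) * f +
        (1 - u * w - (l * m⁻¹ ^ 2) • (d * u ^ 2)) * d * g := by
      rw [mul_assoc _ d g, hg, sub_mul 1, one_mul, mul_assoc, sub_add_cancel]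
    rw [hfg, h.one_sub_mul_one_add hl hm, h.cofactor_mul_d hl hm]
    have h1 : d ^ 2 ∈ RightIdeal.generatedBy
        {d ^ 2, d * u * w + (l⁻¹ * m) • w ^ 2 + m ^ 2 • d} :=
      Submodule.subset_span (Or.inl rfl)
    have h2 : d * u * w + (l⁻¹ * m) • w ^ 2 + m ^ 2 • d ∈ RightIdeal.generatedBy
        {d ^ 2, d * u * w + (l⁻¹ * m) • w ^ 2 + m ^ 2 • d} :=
      Submodule.subset_span (Or.inr rfl)
    exact add_mem (RightIdeal.mul_mem _ (RightIdeal.mul_mem _ h2 _) _) (RightIdeal.mul_mem _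
      (add_mem (RightIdeal.mul_mem _ h2 _) (RightIdeal.mul_mem _ h1 _)) _)
  · rintro x (rfl | rfl)
    · exact RightIdeal.mem_quotient_iff_exists.2 ⟨_, (h.one_add_mul_d_sq hl hm).symm⟩
    · exact RightIdeal.mem_quotient_iff_exists.2 ⟨_, (h.one_add_mul_generator hl hm).symm⟩

theorem w_sq_mem_of_d_mem_quotient (hd : d ∈ RightIdeal.quotient (1 + u * w) d) :
    ∃ y, d * y = w ^ 2 := by
  obtain ⟨g, hg⟩ := RightIdeal.mem_quotient_iff_exists.1 hd
  refine ⟨(m * l) • (1 + (m⁻¹ * l⁻¹) • (u * w) - g), ?_⟩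
  rw [mul_smul_comm, mul_sub, hg, h.one_add_mul_d hl hm, sub_sub_cancel, smul_smul]
  rw [show m * l * (m⁻¹ * l⁻¹) = 1 by field_simp, one_smul]

omit h in
theorem w_sq_mem_of_generator_mem
    (he : d * u * w + (l⁻¹ * m) • w ^ 2 + m ^ 2 • d ∈ RightIdeal.generatedBy {d ^ 2}) :
    ∃ y, d * y = w ^ 2 := by
  obtain ⟨g, hg⟩ := RightIdeal.mem_generatedBy_singleton.1 he
  refine ⟨(l * m⁻¹) • (d * g - u * w - algebraMap k A (m ^ 2)), ?_⟩
  have : d * (d * g - u * w - algebraMap k A (m ^ 2)) = (l⁻¹ * m) • w ^ 2 := by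
    rw [mul_sub, mul_sub, ← mul_assoc d d, ← pow_two, hg, Algebra.algebraMap_eq_smul_one,
      mul_smul_comm, mul_one, ← mul_assoc]
    abel
  rw [mul_smul_comm, this, smul_smul, show l * m⁻¹ * (l⁻¹ * m) = 1 by field_simp, one_smul]

end IsDownUpTriple

end Identities

/-! ### Leading exponents and operators that shift them -/

section LeadingTerms

variable {k ι Γ : Type*} [Field k]

/-- `x` is the leading exponent of `f` with respect to the weight `wt`. -/
def HasLeadingExponent [LT Γ] (wt : ι → Γ) (f : ι →₀ k) (x : ι) : Prop :=
  f x ≠ 0 ∧ ∀ z, f z ≠ 0 → z = x ∨ wt z < wt x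

theorem HasLeadingExponent.unique [Preorder Γ] {wt : ι → Γ} {f : ι →₀ k} {x y : ι}
    (hx : HasLeadingExponent wt f x) (hy : HasLeadingExponent wt f y) : x = y := by
  rcases hy.2 x hx.1 with h | h
  · exact h
  rcases hx.2 y hy.1 with h' | h'
  · exact h'.symm
  · exact absurd (h.trans h') (lt_irrefl _)

theorem exists_hasLeadingExponent [LinearOrder Γ] {wt : ι → Γ} (hwt : Function.Injective wt)
    {f : ι →₀ k} (hf : f ≠ 0) : ∃ x, HasLeadingExponent wt f x := by
  obtain ⟨x, hx, hmax⟩ := f.support.exists_max_image wt (Finsupp.support_nonempty_iff.2 hf)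
  refine ⟨x, Finsupp.mem_support_iff.1 hx, fun z hz ↦ ?_⟩
  rcases (hmax z (Finsupp.mem_support_iff.2 hz)).eq_or_lt with h | h
  · exact .inl (hwt h)
  · exact .inr h

theorem hasLeadingExponent_single [LT Γ] (wt : ι → Γ) (x : ι) {c : k} (hc : c ≠ 0) :
    HasLeadingExponent wt (Finsupp.single x c) x := by
  classical
  refine ⟨by simpa using hc, fun z hz ↦ .inl ?_⟩
  by_contra h
  exact hz (Finsupp.single_eq_of_ne h)

variable [AddCommMonoid ι] [AddCommMonoid Γ] [LinearOrder Γ] [IsOrderedCancelAddMonoid Γ]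

/-- The operator `T` multiplies leading monomials by the monomial of exponent `x`, up to nonzero
scalars. -/
def HasLeadingShift (wt : ι →+ Γ) (T : Module.End k (ι →₀ k)) (x : ι) : Prop :=
  ∀ y, HasLeadingExponent wt (T (Finsupp.single y 1)) (x + y)

namespace HasLeadingShift

variable {wt : ι →+ Γ} {T T' : Module.End k (ι →₀ k)} {x x' : ι}

/-- Terms below y are sent strictly below x + y, so they cannot cancel the image of the leading
term. -/
theorem apply_eq_zero (hT : HasLeadingShift wt T x) {f : ι →₀ k} {y z : ι}
    (hf : ∀ t, f t ≠ 0 → wt t < wt y) (hz : wt (x + y) ≤ wt z) : T f z = 0 := by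
  rw [← f.sum_single, Finsupp.sum, map_sum, Finsupp.finsetSum_apply]
  refine Finset.sum_eq_zero fun t ht ↦ ?_
  rw [← mul_one (f t), ← smul_eq_mul, ← Finsupp.smul_single, map_smul, Finsupp.smul_apply,
    smul_eq_zero]
  right
  by_contra hne
  have hlt : wt (x + t) < wt z := by
    refine lt_of_lt_of_le ?_ hz
    rw [map_add, map_add]
    exact add_lt_add_right (hf t (Finsupp.mem_support_iff.1 ht)) _
  rcases (hT t).2 z hne with h | h
  · exact hlt.ne' (congrArg wt h)
  · exact lt_asymm hlt h

theorem apply (hT : HasLeadingShift wt T x) {f : ι →₀ k} {y : ι}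
    (hf : HasLeadingExponent wt f y) : HasLeadingExponent wt (T f) (x + y) := by
  classical
  have hrest : ∀ t, f.erase y t ≠ 0 → wt t < wt y := by
    intro t ht
    have hty : t ≠ y := fun h ↦ ht (h ▸ Finsupp.erase_same)
    rw [Finsupp.erase_ne hty] at ht
    exact (hf.2 t ht).resolve_left hty
  have hsplit (z : ι) : T f z = f y * T (Finsupp.single y 1) z + T (f.erase y) z := by
    conv_lhs => rw [← Finsupp.single_add_erase y f, map_add, ← mul_one (f y), ← smul_eq_mul,
      ← Finsupp.smul_single, map_smul]
    rfl
  refine ⟨?_, fun z hz ↦ ?_⟩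
  · rw [hsplit, hT.apply_eq_zero hrest le_rfl, add_zero]
    exact mul_ne_zero hf.1 (hT y).1
  · by_contra! h
    rw [hsplit, hT.apply_eq_zero hrest h.2, add_zero] at hz
    rcases (hT y).2 z (right_ne_zero_of_mul hz) with h' | h'
    · exact h.1 h'
    · exact h'.not_ge h.2

theorem mul (hT : HasLeadingShift wt T x) (hT' : HasLeadingShift wt T' x') :
    HasLeadingShift wt (T * T') (x + x') := fun y ↦ by
  rw [add_assoc]
  exact hT.apply (hT' y)

omit [IsOrderedCancelAddMonoid Γ] in
theorem one : HasLeadingShift wt (1 : Module.End k (ι →₀ k)) 0 := fun y ↦ by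
  rw [zero_add]
  exact hasLeadingExponent_single wt y one_ne_zero

theorem pow (hT : HasLeadingShift wt T x) (n : ℕ) : HasLeadingShift wt (T ^ n) (n • x) := by
  induction n with
  | zero => simpa using one
  | succ n ih => rw [pow_succ, succ_nsmul]; exact ih.mul hT

theorem linearCombination {S : ι → Module.End k (ι →₀ k)} (hS : ∀ x, HasLeadingShift wt (S x) x)
    {g : ι →₀ k} (hg : HasLeadingExponent wt g x) :
    HasLeadingShift wt (Finsupp.linearCombination k S g) x := fun y ↦ by
  have hexp (z : ι) : Finsupp.linearCombination k S g (Finsupp.single y 1) z =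
      g.sum fun t c ↦ c * S t (Finsupp.single y 1) z := by
    simp [Finsupp.linearCombination_apply, Finsupp.sum, Finsupp.finsetSum_apply]
  have hzero {z t : ι} (hz : wt (x + y) ≤ wt z) (ht : g t ≠ 0) (htx : t ≠ x) :
      S t (Finsupp.single y 1) z = 0 := by
    by_contra hne
    have hlt : wt (t + y) < wt z := by
      refine lt_of_lt_of_le ?_ hz
      rw [map_add, map_add]
      exact add_lt_add_left ((hg.2 t ht).resolve_left htx) _
    rcases (hS t y).2 z hne with h | h
    · exact hlt.ne' (congrArg wt h)
    · exact lt_asymm hlt h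
  have htop {z : ι} (hz : wt (x + y) ≤ wt z) :
      Finsupp.linearCombination k S g (Finsupp.single y 1) z =
        g x * S x (Finsupp.single y 1) z := by
    rw [hexp]
    refine Finset.sum_eq_single x (fun t ht htx ↦ ?_) fun hx ↦ ?_
    · exact mul_eq_zero_of_right _ (hzero hz (Finsupp.mem_support_iff.1 ht) htx)
    · exact absurd (Finsupp.mem_support_iff.2 hg.1) hx
  refine ⟨?_, fun z hz ↦ ?_⟩
  · rw [htop le_rfl]
    exact mul_ne_zero hg.1 (hS x y).1
  · by_contra! h
    rw [htop h.2] at hz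
    rcases (hS x y).2 z (right_ne_zero_of_mul hz) with h' | h'
    · exact h.1 h'
    · exact h'.not_ge h.2

end HasLeadingShift

end LeadingTerms

/-! ### The model action on normal monomials -/

section NormalForms

variable {k : Type*} [Field k]

/-- The coefficient of `u ^ (i - 1) * w` in the normal form of `d * u ^ i`. -/
def downUpCoeff (l m : k) : ℕ → k
  | 0 => 0
  | i + 1 => l * downUpCoeff l m i + m ^ i

/-- The monomial `u ^ i * w ^ j * d ^ n`. -/
def normalMonomial {A : Type*} [Monoid A] (u w d : A) (x : ℕ × ℕ × ℕ) : A :=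
  u ^ x.1 * (w ^ x.2.1 * d ^ x.2.2)

/-- Left multiplication by `u` on normal monomials. -/
noncomputable def opU (k : Type*) [Field k] : Module.End k (ℕ × ℕ × ℕ →₀ k) :=
  Finsupp.linearCombination k fun x ↦ Finsupp.single (x.1 + 1, x.2.1, x.2.2) 1

/-- Left multiplication by `w` on normal monomials. -/
noncomputable def opW (m : k) : Module.End k (ℕ × ℕ × ℕ →₀ k) :=
  Finsupp.linearCombination k fun x ↦ m ^ x.1 • Finsupp.single (x.1, x.2.1 + 1, x.2.2) 1

/-- Left multiplication by `d` on normal monomials. -/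
noncomputable def opD (l m : k) : Module.End k (ℕ × ℕ × ℕ →₀ k) :=
  Finsupp.linearCombination k fun x ↦
    (l ^ x.1 * m ^ x.2.1) • Finsupp.single (x.1, x.2.1, x.2.2 + 1) 1 +
      -- The coefficient vanishes at `x.1 = 0`, so the truncated subtraction does no harm.
      downUpCoeff l m x.1 • Finsupp.single (x.1 - 1, x.2.1 + 1, x.2.2) 1

theorem opU_single (i j n : ℕ) :
    opU k (Finsupp.single (i, j, n) 1) = Finsupp.single (i + 1, j, n) 1 := by
  simp [opU]

theorem opW_single (m : k) (i j n : ℕ) :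
    opW m (Finsupp.single (i, j, n) 1) = m ^ i • Finsupp.single (i, j + 1, n) 1 := by
  simp [opW]

theorem opD_single (l m : k) (i j n : ℕ) :
    opD l m (Finsupp.single (i, j, n) 1) =
      (l ^ i * m ^ j) • Finsupp.single (i, j, n + 1) 1 +
        downUpCoeff l m i • Finsupp.single (i - 1, j + 1, n) 1 := by
  rw [opD, Finsupp.linearCombination_single, one_smul]

theorem isDownUpTriple_op (l m : k) : IsDownUpTriple l m (opU k) (opW m) (opD l m) where
  w_mul_u := by
    refine Finsupp.lhom_ext' fun ⟨i, j, n⟩ ↦ LinearMap.ext_ring ?_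
    change opW m (opU k (Finsupp.single (i, j, n) 1)) =
      m • opU k (opW m (Finsupp.single (i, j, n) 1))
    rw [opU_single, opW_single, opW_single, map_smul, opU_single, smul_smul, pow_succ']
  d_mul_w := by
    refine Finsupp.lhom_ext' fun ⟨i, j, n⟩ ↦ LinearMap.ext_ring ?_
    change opD l m (opW m (Finsupp.single (i, j, n) 1)) =
      m • opW m (opD l m (Finsupp.single (i, j, n) 1))
    rcases i with _ | i
    · simp only [opW_single, opD_single, map_smul, map_add, downUpCoeff]
      module
    · simp only [opW_single, opD_single, map_smul, map_add, Nat.add_sub_cancel]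
      module
  d_mul_u := by
    refine Finsupp.lhom_ext' fun ⟨i, j, n⟩ ↦ LinearMap.ext_ring ?_
    change opD l m (opU k (Finsupp.single (i, j, n) 1)) =
      l • opU k (opD l m (Finsupp.single (i, j, n) 1)) + opW m (Finsupp.single (i, j, n) 1)
    rcases i with _ | i
    · simp only [opU_single, opW_single, opD_single, map_smul, map_add, downUpCoeff]
      module
    · simp only [opU_single, opW_single, opD_single, map_smul, map_add, downUpCoeff,
        Nat.add_sub_cancel]
      module

namespace IsDownUpTriple

variable {A : Type*} [Ring A] [Algebra k A] {l m : k} {u w d : A}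

theorem w_mul_u_pow (h : IsDownUpTriple l m u w d) (i : ℕ) : w * u ^ i = m ^ i • (u ^ i * w) := by
  induction i with
  | zero => simp
  | succ i ih =>
    rw [pow_succ, ← mul_assoc, ih, smul_mul_assoc, mul_assoc, h.w_mul_u, mul_smul_comm, smul_smul,
      pow_succ, mul_assoc]

theorem d_mul_w_pow (h : IsDownUpTriple l m u w d) (j : ℕ) : d * w ^ j = m ^ j • (w ^ j * d) := by
  induction j with
  | zero => simp
  | succ i ih =>
    rw [pow_succ, ← mul_assoc, ih, smul_mul_assoc, mul_assoc, h.d_mul_w, mul_smul_comm, smul_smul,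
      pow_succ, mul_assoc]

theorem d_mul_u_pow (h : IsDownUpTriple l m u w d) (i : ℕ) :
    d * u ^ i = l ^ i • (u ^ i * d) + downUpCoeff l m i • (u ^ (i - 1) * w) := by
  induction i with
  | zero => simp [downUpCoeff]
  | succ i ih =>
    rw [pow_succ', ← mul_assoc, h.d_mul_u, add_mul, smul_mul_assoc, mul_assoc, ih, h.w_mul_u_pow]
    rcases i with _ | i
    · simp [downUpCoeff]
    · rw [mul_add, mul_smul_comm, mul_smul_comm, Nat.add_sub_cancel, Nat.add_sub_cancel,
        ← mul_assoc, ← mul_assoc, ← pow_succ', ← pow_succ']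
      simp only [downUpCoeff]
      module

/-- Evaluating formal combinations in A intertwines the model operators with left multiplication;
this yields that normal monomials span. -/
theorem linearCombination_opU (f : ℕ × ℕ × ℕ →₀ k) :
    Finsupp.linearCombination k (normalMonomial u w d) (opU k f) =
      u * Finsupp.linearCombination k (normalMonomial u w d) f := by
  suffices H : Finsupp.linearCombination k (normalMonomial u w d) ∘ₗ opU k =
      LinearMap.mulLeft k u ∘ₗ Finsupp.linearCombination k (normalMonomial u w d) from
    LinearMap.congr_fun H f
  refine Finsupp.lhom_ext' fun ⟨i, j, n⟩ ↦ LinearMap.ext_ring ?_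
  simp [opU_single, normalMonomial, pow_succ', mul_assoc]

theorem linearCombination_opD (h : IsDownUpTriple l m u w d) (f : ℕ × ℕ × ℕ →₀ k) :
    Finsupp.linearCombination k (normalMonomial u w d) (opD l m f) =
      d * Finsupp.linearCombination k (normalMonomial u w d) f := by
  suffices H : Finsupp.linearCombination k (normalMonomial u w d) ∘ₗ opD l m =
      LinearMap.mulLeft k d ∘ₗ Finsupp.linearCombination k (normalMonomial u w d) from
    LinearMap.congr_fun H f
  refine Finsupp.lhom_ext' fun ⟨i, j, n⟩ ↦ LinearMap.ext_ring ?_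
  simp only [LinearMap.comp_apply, Finsupp.lsingle_apply, opD_single, map_add, map_smul,
    Finsupp.linearCombination_single, one_smul, LinearMap.mulLeft_apply, normalMonomial]
  rw [← mul_assoc d, h.d_mul_u_pow, add_mul, smul_mul_assoc, smul_mul_assoc, mul_assoc, mul_assoc,
    ← mul_assoc d, h.d_mul_w_pow, ← mul_assoc w, ← pow_succ', smul_mul_assoc, mul_smul_comm,
    smul_smul, mul_assoc _ d, ← pow_succ']

end IsDownUpTriple

theorem opW_pow_single (m : k) (j n : ℕ) :
    (opW m ^ j) (Finsupp.single (0, 0, n) 1) = Finsupp.single (0, j, n) 1 := by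
  induction j with
  | zero => simp
  | succ j ih => rw [pow_succ', Module.End.mul_apply, ih, opW_single, pow_zero, one_smul]

theorem opU_pow_single (i j n : ℕ) :
    (opU k ^ i) (Finsupp.single (0, j, n) 1) = Finsupp.single (i, j, n) 1 := by
  induction i with
  | zero => simp
  | succ i ih => rw [pow_succ', Module.End.mul_apply, ih, opU_single]

theorem opD_pow_single (l m : k) (n : ℕ) :
    (opD l m ^ n) (Finsupp.single 0 1) = Finsupp.single (0, 0, n) 1 := by
  induction n with
  | zero => rfl
  | succ n ih => simp [pow_succ', Module.End.mul_apply, ih, opD_single, downUpCoeff]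

/-- The vector of exponent 0 plays the role of 1. Distinct monomials give distinct basis vectors,
hence linear independence. -/
theorem normalMonomial_op_single (l m : k) (x : ℕ × ℕ × ℕ) :
    normalMonomial (opU k) (opW m) (opD l m) x (Finsupp.single 0 1) = Finsupp.single x 1 := by
  rw [normalMonomial, Module.End.mul_apply, Module.End.mul_apply, opD_pow_single, opW_pow_single,
    opU_pow_single]

/-- The weight comparing `u ^ i * w ^ j * d ^ n` by the degree in `u`, then by `n`, then by `j`. -/
def normalWeight : ℕ × ℕ × ℕ →+ ℕ ×ₗ (ℕ ×ₗ ℕ) where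
  toFun x := toLex (x.1 + x.2.1, toLex (x.2.2, x.2.1))
  map_zero' := rfl
  map_add' x y :=
    congrArg toLex (Prod.ext (add_add_add_comm x.1 y.1 x.2.1 y.2.1) rfl)

theorem normalWeight_injective : Function.Injective normalWeight := by
  rintro ⟨i, j, n⟩ ⟨i', j', n'⟩ h
  have h1 : (i + j, toLex (n, j)) = (i' + j', toLex (n', j')) := h
  have h2 : i + j = i' + j' := congrArg Prod.fst h1
  have h3 : (n, j) = (n', j') := congrArg Prod.snd h1
  simp only [Prod.mk.injEq] at h3 ⊢
  omega

theorem hasLeadingShift_opU : HasLeadingShift normalWeight (opU k) (1, 0, 0) := by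
  rintro ⟨i, j, n⟩
  rw [opU_single, Prod.mk_add_mk, Prod.mk_add_mk, zero_add, zero_add, add_comm 1]
  exact hasLeadingExponent_single _ _ one_ne_zero

theorem hasLeadingShift_opW {m : k} (hm : m ≠ 0) :
    HasLeadingShift normalWeight (opW m) (0, 1, 0) := by
  rintro ⟨i, j, n⟩
  rw [opW_single, Prod.mk_add_mk, Prod.mk_add_mk, zero_add, zero_add, add_comm 1,
    Finsupp.smul_single, smul_eq_mul, mul_one]
  exact hasLeadingExponent_single _ _ (pow_ne_zero _ hm)

/-- Both terms of d u^i w^j d^n have u-degree i + j, as w has u-degree 1. The tie is broken by the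
exponent of d, in favour of the term that gains a d. -/
theorem hasLeadingShift_opD {l m : k} (hl : l ≠ 0) (hm : m ≠ 0) :
    HasLeadingShift normalWeight (opD l m) (0, 0, 1) := by
  rintro ⟨i, j, n⟩
  rw [opD_single, Prod.mk_add_mk, Prod.mk_add_mk, zero_add, zero_add, add_comm 1]
  refine ⟨?_, fun z hz ↦ ?_⟩
  · have hne : (i, j, n + 1) ≠ (i - 1, j + 1, n) := by simp
    simp [Finsupp.single_eq_of_ne hne, hl, hm]
  · by_contra! hcon
    have hz1 : z ≠ (i, j, n + 1) := hcon.1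
    rw [Finsupp.add_apply, Finsupp.smul_apply, Finsupp.single_eq_of_ne hz1, smul_zero,
      zero_add, Finsupp.smul_apply, smul_ne_zero_iff] at hz
    have hz2 : z = (i - 1, j + 1, n) := by
      by_contra hne
      exact hz.2 (Finsupp.single_eq_of_ne hne)
    rcases i with _ | i
    · exact hz.1 rfl
    · subst hz2
      refine hcon.2.not_gt (Prod.Lex.toLex_lt_toLex.2 (.inr ⟨?_, ?_⟩))
      · simp only [Nat.add_sub_cancel]
        omega
      · exact Prod.Lex.toLex_lt_toLex.2 (.inl (Nat.lt_succ_self n))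

theorem hasLeadingShift_normalMonomial {l m : k} (hl : l ≠ 0) (hm : m ≠ 0) (x : ℕ × ℕ × ℕ) :
    HasLeadingShift normalWeight (normalMonomial (opU k) (opW m) (opD l m) x) x := by
  obtain ⟨i, j, n⟩ := x
  have h := (hasLeadingShift_opU.pow i).mul
    (((hasLeadingShift_opW hm).pow j).mul ((hasLeadingShift_opD hl hm).pow n))
  have hx : (i, j, n) = i • ((1, 0, 0) : ℕ × ℕ × ℕ) + (j • (0, 1, 0) + n • (0, 0, 1)) := by
    simp
  rw [← hx] at h
  exact h

end NormalForms

/-! ### The down-up algebra: normal forms and factorizations -/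

namespace DownUpAlgebra

variable {k : Type*} [Field k] {α β l m : k}

theorem d_mul_u_sq (α β : k) :
    d α β 0 * u α β 0 ^ 2 =
      α • (u α β 0 * d α β 0 * u α β 0) + β • (u α β 0 ^ 2 * d α β 0) := by
  simpa [d, u] using RingQuot.mkAlgHom_rel k (DownUpRel.up_rel (α := α) (β := β) (γ := 0))

theorem d_sq_mul_u (α β : k) :
    d α β 0 ^ 2 * u α β 0 =
      α • (d α β 0 * u α β 0 * d α β 0) + β • (u α β 0 * d α β 0 ^ 2) := by
  simpa [d, u] using RingQuot.mkAlgHom_rel k (DownUpRel.down_rel (α := α) (β := β) (γ := 0))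

theorem isDownUpTriple (hα : α = l + m) (hβ : β = -(l * m)) :
    IsDownUpTriple l m (u α β 0) (omega α β 0 l) (d α β 0) where
  w_mul_u := by
    have h := d_mul_u_sq α β
    rw [pow_two, ← mul_assoc] at h
    rw [omega, sub_mul, h, mul_sub, smul_mul_assoc, mul_smul_comm, hα, hβ]
    simp only [← mul_assoc]
    module
  d_mul_w := by
    have h := d_sq_mul_u α β
    rw [pow_two, mul_assoc] at h
    rw [omega, mul_sub, h, sub_mul, smul_mul_assoc, mul_smul_comm, hα, hβ]
    simp only [mul_assoc]
    module
  d_mul_u := by rw [omega, add_sub_cancel]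

/-- The algebra homomorphism out of `A(α, β, 0)` given by two elements that satisfy the defining
relations. -/
noncomputable def lift {A : Type*} [Ring A] [Algebra k A] (x y w : A)
    (hα : α = l + m) (hβ : β = -(l * m)) (h : IsDownUpTriple l m x w y) :
    DownUpAlgebra α β 0 →ₐ[k] A :=
  RingQuot.liftAlgHom k ⟨FreeAlgebra.lift k fun | .up => x | .down => y, by
    rintro _ _ (_ | _)
    · simp only [map_mul, map_add, map_smul, FreeAlgebra.lift_ι_apply, zero_smul, add_zero,
        pow_two, mul_assoc, h.d_mul_u_mul, h.d_mul_u, h.w_mul_u, mul_add, mul_smul_comm, hα, hβ]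
      module
    -- Eliminating w turns the relation for d w into the second defining relation.
    · have hw : w * y = y * x * y - l • (x * y * y) := by
        rw [h.d_mul_u, add_mul, smul_mul_assoc, add_sub_cancel_left]
      have hyyx : y * y * x = l • (y * x * y) + m • (y * x * y - l • (x * y * y)) := by
        rw [mul_assoc y y x, h.d_mul_u, mul_add, mul_smul_comm, h.d_mul_w, hw, ← h.d_mul_u,
          ← mul_assoc]
      simp only [map_mul, map_add, map_smul, FreeAlgebra.lift_ι_apply, zero_smul, add_zero,
        pow_two, hα, hβ, hyyx, ← mul_assoc]
      module⟩

section Lift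

variable {A : Type*} [Ring A] [Algebra k A] {x y w : A} (hα : α = l + m) (hβ : β = -(l * m))
  (h : IsDownUpTriple l m x w y)

theorem lift_u : lift x y w hα hβ h (u α β 0) = x := by
  simp [lift, u]

theorem lift_d : lift x y w hα hβ h (d α β 0) = y := by
  simp [lift, d]

theorem lift_omega : lift x y w hα hβ h (omega α β 0 l) = w := by
  rw [omega, map_sub, map_smul, map_mul, map_mul, lift_u, lift_d, h.d_mul_u, add_sub_cancel_left]

end Lift

@[elab_as_elim]
theorem induction {P : DownUpAlgebra α β 0 → Prop} (hc : ∀ c : k, P (algebraMap k _ c))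
    (hu : P (u α β 0)) (hd : P (d α β 0)) (hmul : ∀ a b, P a → P b → P (a * b))
    (hadd : ∀ a b, P a → P b → P (a + b)) (a : DownUpAlgebra α β 0) : P a := by
  obtain ⟨a, rfl⟩ := RingQuot.mkAlgHom_surjective k (DownUpRel α β 0) a
  induction a using FreeAlgebra.induction with
  | grade0 c => simpa using hc c
  | grade1 g => cases g; exacts [hu, hd]
  | mul a b ha hb => rw [map_mul]; exact hmul _ _ ha hb
  | add a b ha hb => rw [map_add]; exact hadd _ _ ha hb

/-- The augmentation u, d ↦ 0 is a homomorphism to the field k. -/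
theorem invariantBasisNumber (hα : α = l + m) (hβ : β = -(l * m)) :
    InvariantBasisNumber (DownUpAlgebra α β 0) :=
  .of_ringHom (lift (0 : k) 0 0 hα hβ ⟨by simp, by simp, by simp⟩).toRingHom

/-- The action of `A(α, β, 0)` on the span of the normal monomials. -/
noncomputable def normalRep (hα : α = l + m) (hβ : β = -(l * m)) :
    DownUpAlgebra α β 0 →ₐ[k] Module.End k (ℕ × ℕ × ℕ →₀ k) :=
  lift (opU k) (opD l m) (opW m) hα hβ (isDownUpTriple_op l m)

/-- The coordinates of an element of `A(α, β, 0)` in normal monomials. -/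
noncomputable def normalForm (hα : α = l + m) (hβ : β = -(l * m)) :
    DownUpAlgebra α β 0 →ₗ[k] (ℕ × ℕ × ℕ →₀ k) :=
  LinearMap.applyₗ (Finsupp.single 0 1) ∘ₗ (normalRep hα hβ).toLinearMap

section NormalForm

variable (hα : α = l + m) (hβ : β = -(l * m))

theorem normalForm_apply (a : DownUpAlgebra α β 0) :
    normalForm hα hβ a = normalRep hα hβ a (Finsupp.single 0 1) :=
  rfl

theorem normalForm_mul (a b : DownUpAlgebra α β 0) :
    normalForm hα hβ (a * b) = normalRep hα hβ a (normalForm hα hβ b) := by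
  rw [normalForm_apply, map_mul, Module.End.mul_apply, normalForm_apply]

theorem normalRep_normalMonomial (x : ℕ × ℕ × ℕ) :
    normalRep hα hβ (normalMonomial (u α β 0) (omega α β 0 l) (d α β 0) x) =
      normalMonomial (opU k) (opW m) (opD l m) x := by
  simp only [normalMonomial, map_mul, map_pow, normalRep, lift_u, lift_d, lift_omega]

theorem normalForm_normalMonomial (x : ℕ × ℕ × ℕ) :
    normalForm hα hβ (normalMonomial (u α β 0) (omega α β 0 l) (d α β 0) x) =
      Finsupp.single x 1 := by
  rw [normalForm_apply, normalRep_normalMonomial, normalMonomial_op_single]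

theorem linearCombination_normalRep (a : DownUpAlgebra α β 0) (f : ℕ × ℕ × ℕ →₀ k) :
    Finsupp.linearCombination k (normalMonomial (u α β 0) (omega α β 0 l) (d α β 0))
        (normalRep hα hβ a f) =
      a * Finsupp.linearCombination k
        (normalMonomial (u α β 0) (omega α β 0 l) (d α β 0)) f := by
  induction a using DownUpAlgebra.induction generalizing f with
  | hc c => rw [AlgHom.commutes, Module.algebraMap_end_apply, map_smul, Algebra.smul_def]
  | hu => rw [normalRep, lift_u, IsDownUpTriple.linearCombination_opU]
  | hd => rw [normalRep, lift_d, (isDownUpTriple hα hβ).linearCombination_opD]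
  | hmul a b ha hb => rw [map_mul, Module.End.mul_apply, ha, hb, mul_assoc]
  | hadd a b ha hb => rw [map_add, LinearMap.add_apply, map_add, ha, hb, add_mul]

theorem linearCombination_normalForm (a : DownUpAlgebra α β 0) :
    Finsupp.linearCombination k (normalMonomial (u α β 0) (omega α β 0 l) (d α β 0))
      (normalForm hα hβ a) = a := by
  rw [normalForm_apply, linearCombination_normalRep, Finsupp.linearCombination_single, one_smul,
    normalMonomial]
  simp

theorem normalForm_ne_zero {a : DownUpAlgebra α β 0} (ha : a ≠ 0) : normalForm hα hβ a ≠ 0 := by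
  intro h
  have h' := linearCombination_normalForm hα hβ a
  rw [h, map_zero] at h'
  exact ha h'.symm

variable (hl : l ≠ 0) (hm : m ≠ 0)
include hl hm

/-- Leading exponents are additive. -/
theorem hasLeadingExponent_mul {a b : DownUpAlgebra α β 0} {x y : ℕ × ℕ × ℕ}
    (ha : HasLeadingExponent normalWeight (normalForm hα hβ a) x)
    (hb : HasLeadingExponent normalWeight (normalForm hα hβ b) y) :
    HasLeadingExponent normalWeight (normalForm hα hβ (a * b)) (x + y) := by
  rw [normalForm_mul]
  refine HasLeadingShift.apply ?_ hb
  -- The action of a is the combination of monomial operators given by its normal form, and each of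
  -- these shifts leading exponents by its own exponent.
  have hrep : normalRep hα hβ a = Finsupp.linearCombination k
      (normalMonomial (opU k) (opW m) (opD l m)) (normalForm hα hβ a) := by
    conv_lhs => rw [← linearCombination_normalForm hα hβ a]
    simp only [Finsupp.linearCombination_apply, Finsupp.sum, map_sum, map_smul,
      normalRep_normalMonomial]
  rw [hrep]
  exact HasLeadingShift.linearCombination (hasLeadingShift_normalMonomial hl hm) ha

theorem exists_hasLeadingExponent_of_mul {a b : DownUpAlgebra α β 0} {z : ℕ × ℕ × ℕ}
    (h : HasLeadingExponent normalWeight (normalForm hα hβ (a * b)) z) :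
    ∃ x y, HasLeadingExponent normalWeight (normalForm hα hβ a) x ∧
      HasLeadingExponent normalWeight (normalForm hα hβ b) y ∧ x + y = z := by
  have hab : a * b ≠ 0 := fun h0 ↦ h.1 (by rw [h0, map_zero, Finsupp.zero_apply])
  obtain ⟨x, hx⟩ := exists_hasLeadingExponent normalWeight_injective
    (normalForm_ne_zero hα hβ (left_ne_zero_of_mul hab))
  obtain ⟨y, hy⟩ := exists_hasLeadingExponent normalWeight_injective
    (normalForm_ne_zero hα hβ (right_ne_zero_of_mul hab))
  exact ⟨x, y, hx, hy, (hasLeadingExponent_mul hα hβ hl hm hx hy).unique h⟩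

include hα hβ in
theorem noZeroDivisors : NoZeroDivisors (DownUpAlgebra α β 0) where
  eq_zero_or_eq_zero_of_mul_eq_zero {a b} hab := by
    by_contra! h
    obtain ⟨x, hx⟩ := exists_hasLeadingExponent normalWeight_injective
      (normalForm_ne_zero hα hβ h.1)
    obtain ⟨y, hy⟩ := exists_hasLeadingExponent normalWeight_injective
      (normalForm_ne_zero hα hβ h.2)
    have hxy := hasLeadingExponent_mul hα hβ hl hm hx hy
    rw [hab, map_zero] at hxy
    exact hxy.1 rfl

omit hl hm in
theorem hasLeadingExponent_normalMonomial (x : ℕ × ℕ × ℕ) :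
    HasLeadingExponent normalWeight (normalForm hα hβ
      (normalMonomial (u α β 0) (omega α β 0 l) (d α β 0) x)) x := by
  rw [normalForm_normalMonomial]
  exact hasLeadingExponent_single _ _ one_ne_zero

-- The leading exponent of d y has d-coordinate at least 1, while that of w² is (0, 2, 0).
include hα hβ in
theorem d_mul_ne_omega_sq (y : DownUpAlgebra α β 0) : d α β 0 * y ≠ omega α β 0 l ^ 2 := by
  intro h
  have hw := hasLeadingExponent_normalMonomial hα hβ (0, 2, 0)
  have hd := hasLeadingExponent_normalMonomial hα hβ (0, 0, 1)
  simp only [normalMonomial, pow_zero, one_mul, mul_one, pow_one] at hw hd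
  rw [← h] at hw
  obtain ⟨x, z, hx, -, hxz⟩ := exists_hasLeadingExponent_of_mul hα hβ hl hm hw
  rw [hx.unique hd] at hxz
  have := congrArg (fun t ↦ t.2.2) hxz
  simp at this

-- Polynomials in d are recovered from their normal forms, so k[X] embeds in A.
omit hl hm in
theorem normalForm_aeval_d (P : Polynomial k) (n : ℕ) :
    normalForm hα hβ (Polynomial.aeval (d α β 0) P) (0, 0, n) = P.coeff n := by
  suffices H : Finsupp.lapply (0, 0, n) ∘ₗ normalForm hα hβ ∘ₗ
      (Polynomial.aeval (d α β 0)).toLinearMap = Polynomial.lcoeff k n from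
    LinearMap.congr_fun H P
  refine Polynomial.lhom_ext' fun i ↦ LinearMap.ext_ring ?_
  have hd := normalForm_normalMonomial hα hβ (0, 0, i)
  simp only [normalMonomial, pow_zero, one_mul] at hd
  simp [Polynomial.aeval_monomial, Polynomial.coeff_monomial, hd, Finsupp.single_apply]

omit hl hm in
/-- An element whose leading monomial is a power of `d` is a polynomial in `d`. -/
theorem exists_aeval_d_eq {a : DownUpAlgebra α β 0} {n : ℕ}
    (ha : HasLeadingExponent normalWeight (normalForm hα hβ a) (0, 0, n)) :
    ∃ P : Polynomial k, Polynomial.aeval (d α β 0) P = a := by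
  suffices H : a ∈ (Polynomial.aeval (R := k) (d α β 0)).range from (AlgHom.mem_range _).1 H
  rw [← linearCombination_normalForm hα hβ a, Finsupp.linearCombination_apply]
  refine sum_mem fun x hx ↦ Subalgebra.smul_mem _
    ((AlgHom.mem_range _).2 ⟨Polynomial.X ^ x.2.2, ?_⟩) _
  -- The weight compares u-degree first, so a leading term of u-degree 0 forces u-degree 0 on every
  -- term.
  have hx0 : x.1 + x.2.1 = 0 := by
    rcases ha.2 x (Finsupp.mem_support_iff.1 hx) with rfl | h
    · rfl
    · rcases Prod.Lex.toLex_lt_toLex.1 h with h' | h'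
      · exact absurd h' (Nat.not_lt_zero _)
      · exact h'.1
  have h1 : x.1 = 0 := by omega
  have h2 : x.2.1 = 0 := by omega
  simp [normalMonomial, h1, h2]

include hα hβ in
/-- Up to right unit factors, the left divisors of `d ^ 2` are powers of `d`. -/
theorem exists_eq_d_pow_mul_of_mul_eq_d_sq {g a : DownUpAlgebra α β 0}
    (h : g * a = d α β 0 ^ 2) :
    ∃ i ≤ 2, ∃ v w, v * w = 1 ∧ g = d α β 0 ^ i * v := by
  have hd := hasLeadingExponent_normalMonomial hα hβ (0, 0, 2)
  simp only [normalMonomial, pow_zero, one_mul] at hd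
  rw [← h] at hd
  obtain ⟨⟨x1, x2, x3⟩, ⟨y1, y2, y3⟩, hx, hy, hxy⟩ :=
    exists_hasLeadingExponent_of_mul hα hβ hl hm hd
  simp only [Prod.mk_add_mk, Prod.mk.injEq] at hxy
  -- Exponents of the factors are natural numbers adding to (0, 0, 2), so both leading monomials are
  -- powers of d.
  obtain ⟨rfl, rfl⟩ : x1 = 0 ∧ x2 = 0 := by omega
  obtain ⟨rfl, rfl⟩ : y1 = 0 ∧ y2 = 0 := by omega
  obtain ⟨P, rfl⟩ := exists_aeval_d_eq hα hβ hx
  obtain ⟨Q, rfl⟩ := exists_aeval_d_eq hα hβ hy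
  have hPQ : P * Q = Polynomial.X ^ 2 := by
    ext n
    rw [← normalForm_aeval_d hα hβ, map_mul, h, ← normalForm_aeval_d hα hβ,
      map_pow (Polynomial.aeval _), Polynomial.aeval_X]
  obtain ⟨i, hi, hP⟩ := (dvd_prime_pow Polynomial.prime_X 2).1 (Dvd.intro Q hPQ)
  obtain ⟨v, hv⟩ := hP.symm
  refine ⟨i, hi, Polynomial.aeval (d α β 0) (v : Polynomial k),
    Polynomial.aeval (d α β 0) ((v⁻¹ : (Polynomial k)ˣ) : Polynomial k), ?_, ?_⟩
  · rw [← map_mul, Units.mul_inv, map_one]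
  · rw [← hv, map_mul, map_pow, Polynomial.aeval_X]

-- A single generator would be d^i up to a right unit factor, with i ≤ 2; each i would put w² in dA.
include hα hβ in
theorem quotient_ne_generatedBy_singleton (g : DownUpAlgebra α β 0) :
    RightIdeal.quotient (1 + u α β 0 * omega α β 0 l) (d α β 0) ≠
      RightIdeal.generatedBy {g} := by
  intro hK
  have ht := isDownUpTriple hα hβ
  have hgen := ht.quotient_eq_generatedBy hl hm
  have hd2 : d α β 0 ^ 2 ∈ RightIdeal.generatedBy {g} := by
    rw [← hK, hgen]
    exact Submodule.subset_span (Or.inl rfl)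
  obtain ⟨a, ha⟩ := RightIdeal.mem_generatedBy_singleton.1 hd2
  obtain ⟨i, hi, v, w, hvw, rfl⟩ := exists_eq_d_pow_mul_of_mul_eq_d_sq hα hβ hl hm ha
  have hpow : RightIdeal.generatedBy {d α β 0 ^ i * v} = RightIdeal.generatedBy {d α β 0 ^ i} := by
    refine le_antisymm ((Submodule.span_singleton_le_iff_mem _ _).2 ?_)
      ((Submodule.span_singleton_le_iff_mem _ _).2 ?_)
    · exact RightIdeal.mem_generatedBy_singleton.2 ⟨v, rfl⟩
    · exact RightIdeal.mem_generatedBy_singleton.2 ⟨w, by rw [mul_assoc, hvw, mul_one]⟩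
  rw [hpow] at hK
  suffices H : ∃ y, d α β 0 * y = omega α β 0 l ^ 2 by
    obtain ⟨y, hy⟩ := H
    exact d_mul_ne_omega_sq hα hβ hl hm y hy
  rcases hi.lt_or_eq with hi | rfl
  · refine ht.w_sq_mem_of_d_mem_quotient hl hm ?_
    rw [hK]
    refine RightIdeal.mem_generatedBy_singleton.2 ⟨d α β 0 ^ (1 - i), ?_⟩
    rw [← pow_add, Nat.add_sub_of_le (Nat.lt_succ_iff.1 hi), pow_one]
  · refine IsDownUpTriple.w_sq_mem_of_generator_mem (u := u α β 0) hl hm ?_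
    rw [← hK, hgen]
    exact Submodule.subset_span (Or.inr rfl)

end NormalForm

end DownUpAlgebra

open DownUpAlgebra in
theorem proposition4 {k : Type*} [Field k] [CharZero k] (α β l m : k)
    (hβ : β ≠ 0) (hα : α = l + m) (hlm : β = -(l * m)) :
    ∃ K : RightIdeal (DownUpAlgebra α β 0),
      Module.Finite (DownUpAlgebra α β 0)ᵐᵒᵖ K ∧
      Module.IsStablyFree (DownUpAlgebra α β 0)ᵐᵒᵖ K ∧
      ¬ Module.Free (DownUpAlgebra α β 0)ᵐᵒᵖ K ∧
      (∀ f : DownUpAlgebra α β 0,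
        f ∈ K ↔
          (1 + u α β 0 * omega α β 0 l) * f ∈ RightIdeal.generatedBy {d α β 0}) ∧
      Nonempty (K ≃ₗ[(DownUpAlgebra α β 0)ᵐᵒᵖ]
        ↥(RightIdeal.generatedBy {1 + u α β 0 * omega α β 0 l} ⊓
          RightIdeal.generatedBy {d α β 0})) ∧
      K = RightIdeal.generatedBy
        {d α β 0 ^ 2,
          d α β 0 * u α β 0 * omega α β 0 l + (l⁻¹ * m) • omega α β 0 l ^ 2 +
            m ^ 2 • d α β 0} := by
  have hl : l ≠ 0 := by rintro rfl; simp at hlm; exact hβ hlm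
  have hm : m ≠ 0 := by rintro rfl; simp at hlm; exact hβ hlm
  have ht := isDownUpTriple hα hlm
  have hgen := ht.quotient_eq_generatedBy hl hm
  have hone := ht.one_add_mul_add_eq_one hm
  have hwsq := d_mul_ne_omega_sq hα hlm hl hm
  have hdomain := noZeroDivisors hα hlm hl hm
  have hibn := invariantBasisNumber hα hlm
  have hd0 : d α β 0 ≠ 0 := fun h0 ↦ by
    have h1 := hasLeadingExponent_normalMonomial hα hlm (0, 0, 1)
    refine h1.1 ?_
    simp [normalMonomial, h0]
  have hd (x : DownUpAlgebra α β 0) (hx : d α β 0 * x = 0) : x = 0 :=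
    (mul_eq_zero.1 hx).resolve_left hd0
  -- If r = 0, the certificate makes d right invertible, so w² would lie in dA.
  have hr0 : 1 + u α β 0 * omega α β 0 l ≠ 0 := fun h0 ↦ by
    rw [h0, zero_mul, zero_add] at hone
    exact hwsq _ (by rw [← mul_assoc, hone, one_mul])
  have hfinite : Module.Finite (DownUpAlgebra α β 0)ᵐᵒᵖ
      (RightIdeal.quotient (1 + u α β 0 * omega α β 0 l) (d α β 0)) := by
    rw [hgen]
    exact Module.Finite.span_of_finite _ (Set.toFinite _)
  refine ⟨RightIdeal.quotient (1 + u α β 0 * omega α β 0 l) (d α β 0), hfinite,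
    RightIdeal.isStablyFree_quotient hd hone, fun hfree ↦ ?_,
    fun f ↦ RightIdeal.mem_quotient,
    RightIdeal.quotient_equiv_inf _ fun x hx ↦ (mul_eq_zero.1 hx).resolve_left hr0, hgen⟩
  obtain ⟨e⟩ := RightIdeal.prod_equiv_quotient_prod hd hone
  obtain ⟨g, hg⟩ := RightIdeal.exists_eq_generatedBy_singleton _ e
  exact quotient_ne_generatedBy_singleton hα hlm hl hm g hg
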